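/- Let $k$ be an algebraically closed field and let $F$ be a subfield of $k$. Let $S$ be an algebraic semigroup over $k$, that is, a variety over $k$ (a reduced separated scheme of finite type over $k$, not necessarily irreducible or affine) equipped with an associative morphism $\mu : S\times_k S\to S$. Assume that $S$ is defined over $F$: there are a scheme $S_0$ over $F$, an isomorphism $S\cong S_0\times_F k$ over $k$, and an $F$-morphism $\mu_0 : S_0\times_F S_0\to S_0$ whose base change to $k$ is $\mu$. Let $S(F)\subseteq S(k)$ be the semigroup of $F$-points, i.e. of those $k$-points of $S$ that are induced by $F$-points of $S_0$. Then $S(F)$ is strongly $\pi$-regular: for every $x\in S(F)$ there exist an integer $n>0$ and an idempotent $e\in S(F)$ such that $x^n$ belongs to the unit group of the monoid $eS(F)e$ (whose neutral element is $e$). -/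

import Mathlib

open CategoryTheory Limits MonoidalCategory CartesianMonoidalCategory AlgebraicGeometry

universe u

section AbstractSemigroups

/-- The positive powers `x ^ n` of an element of a semigroup:
`x ^ 1 = x` and `x ^ (n + 1) = x ^ n * x`. -/
def semigroupPow {M : Type*} [Semigroup M] (x : M) (n : ℕ+) : M :=
  PNat.recOn n x fun _ y => y * x

/-- For an idempotent `e` of a semigroup `M`, the semigroup `eMe` is a monoid with
neutral element `e`. -/
instance cornerMonoid {M : Type*} [Semigroup M] {e : M} (he : IsIdempotentElem e) :
    Monoid he.Corner where
  __ : Semigroup he.Corner := inferInstanceAs (Semigroup (Subsemigroup.corner e))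
  one := ⟨e, e, by simp_rw [he.eq]⟩
  one_mul r := Subtype.ext ((Subsemigroup.mem_corner_iff he).mp r.2).1
  mul_one r := Subtype.ext ((Subsemigroup.mem_corner_iff he).mp r.2).2

/-- A semigroup `M` is strongly `π`-regular if for every `x` in `M` there are a positive
integer `n` and an idempotent `e` of `M` such that `x ^ n` lies in the unit group of the
monoid `eMe`. -/
def IsStronglyPiRegular (M : Type*) [Semigroup M] : Prop :=
  ∀ x : M, ∃ (n : ℕ+) (e : M) (he : IsIdempotentElem e) (u : he.Cornerˣ),
    (u : he.Corner).1 = semigroupPow x n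

end AbstractSemigroups

noncomputable section

/-- An algebraic semigroup over `k`: a variety over `k` (a reduced, separated scheme of finite
type, not necessarily irreducible, affine or nonempty) with an associative morphism
`S × S ⟶ S`. -/
structure AlgebraicSemigroup (k : Type u) [Field k] where
  /-- the underlying scheme over `k` -/
  X : Over (Spec (CommRingCat.of k))
  reduced : IsReduced X.left
  separated : IsSeparated X.hom
  locallyOfFiniteType : LocallyOfFiniteType X.hom
  quasiCompact : QuasiCompact X.hom
  /-- the multiplication -/
  mul : X ⊗ X ⟶ X
  mul_assoc : mul ▷ X ≫ mul = (α_ X X X).hom ≫ X ◁ mul ≫ mul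

namespace AlgebraicSemigroup

variable {k : Type u} [Field k]

/-- The set `S(k)` of `k`-points of `S`, that is, of sections of `S ⟶ Spec k`. -/
def Points (S : AlgebraicSemigroup k) : Type u :=
  𝟙_ (Over (Spec (CommRingCat.of k))) ⟶ S.X

theorem lift_mul_assoc (S : AlgebraicSemigroup k) {T : Over (Spec (CommRingCat.of k))}
    (x y z : T ⟶ S.X) :
    lift (lift x y ≫ S.mul) z ≫ S.mul = lift x (lift y z ≫ S.mul) ≫ S.mul := by
  have h := congrArg (fun f => lift (lift x y) z ≫ f) S.mul_assoc
  simpa using h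

/-- `S(k)` is a semigroup under the multiplication `(x, y) ↦ μ ∘ (x, y)`. -/
instance (S : AlgebraicSemigroup k) : Semigroup S.Points where
  mul x y := lift x y ≫ S.mul
  mul_assoc x y z :=
    S.lift_mul_assoc x y z

/-- The morphism `Spec k ⟶ Spec F` given by a field extension `k` of `F`. -/
abbrev specMap (F k : Type u) [Field F] [Field k] [Algebra F k] :
    Spec (CommRingCat.of k) ⟶ Spec (CommRingCat.of F) :=
  Spec.map (CommRingCat.ofHom (algebraMap F k))

/-- An `F`-structure on the algebraic semigroup `S` over `k`, for a subfield `F` of `k`: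
a scheme `X₀` over `F` together with an identification of `S` with the base change of `X₀`
to `k`, such that the multiplication of `S` is the base change of an `F`-morphism
`X₀ × X₀ ⟶ X₀`. (Since `S` is separated and of finite type over `k`, so is `X₀` over `F`, and
the multiplication of `X₀` is associative because that of `S` is.) -/
structure FStructure (F : Type u) [Field F] [Algebra F k] (S : AlgebraicSemigroup k) where
  /-- the `F`-form of the underlying variety -/
  X₀ : Over (Spec (CommRingCat.of F))
  /-- the projection of the base change `S = X₀ ×_F k` to `X₀` -/
  proj : S.X.left ⟶ X₀.left
  isPullback : IsPullback proj S.X.hom X₀.hom (specMap F k)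
  /-- the `F`-form of the multiplication -/
  mul₀ : X₀ ⊗ X₀ ⟶ X₀
  mul_proj : S.mul.left ≫ proj =
    pullback.map S.X.hom S.X.hom X₀.hom X₀.hom proj proj (specMap F k)
      isPullback.w.symm isPullback.w.symm ≫ mul₀.left

namespace FStructure

variable {F : Type u} [Field F] [Algebra F k] {S : AlgebraicSemigroup k}

/-- A `k`-point `x` of `S` is an `F`-point (is defined over `F`) if it is the base change of a
section of the `F`-form `X₀ ⟶ Spec F`. -/
def IsRational (A : S.FStructure F) (x : S.Points) : Prop :=
  ∃ x₀ : 𝟙_ (Over (Spec (CommRingCat.of F))) ⟶ A.X₀,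
    Over.Hom.left x ≫ A.proj = specMap F k ≫ x₀.left

theorem lift_mul_proj (A : S.FStructure F)
    {x y : 𝟙_ (Over (Spec (CommRingCat.of k))) ⟶ S.X}
    {x₀ y₀ : 𝟙_ (Over (Spec (CommRingCat.of F))) ⟶ A.X₀}
    (hx : x.left ≫ A.proj = specMap F k ≫ x₀.left)
    (hy : y.left ≫ A.proj = specMap F k ≫ y₀.left) :
    (lift x y ≫ S.mul).left ≫ A.proj = specMap F k ≫ (lift x₀ y₀ ≫ A.mul₀).left := by
  rw [Over.comp_left, Over.comp_left, Category.assoc, A.mul_proj, ← Category.assoc,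
    ← Category.assoc]
  congr 1
  apply pullback.hom_ext
  · rw [Category.assoc, Category.assoc, Over.lift_left, Over.lift_left, pullback.map,
      pullback.lift_fst, pullback.lift_fst, pullback.lift_fst_assoc, hx]
  · rw [Category.assoc, Category.assoc, Over.lift_left, Over.lift_left, pullback.map,
      pullback.lift_snd, pullback.lift_snd, pullback.lift_snd_assoc, hy]

/-- The semigroup `S(F)` of `F`-points of `S`. -/
def rationalPoints (A : S.FStructure F) : Subsemigroup S.Points where
  carrier := {x | A.IsRational x}
  mul_mem' := by
    rintro x y ⟨x₀, hx⟩ ⟨y₀, hy⟩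
    exact ⟨lift x₀ y₀ ≫ A.mul₀, A.lift_mul_proj hx hy⟩

end FStructure

end AlgebraicSemigroup

end

/-! ### Powers and group inverses in abstract semigroups -/

section Semigroups

variable {M : Type*} [Semigroup M]

/-! Over `k`, consider the shear `(a, b) ↦ (a, ab)` on `S × S` and the closure `Z` of the pairs of
sufficiently high powers of `x`. The shear maps `Z` to a dense subset of `Z`, constructible by
Chevalley, which therefore contains a nonempty relatively open subset of `Z`. That subset contains a
pair whose first exponent is the larger, so `x ^ j ∈ x ^ i * S(k)` with `j < i`
(`exists_mem_range_of_shear`, `exists_lift_comp_eq`). With the same for the opposite multiplication,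
some power of `x` has a group inverse.

Group inverses are unique in any semigroup, in particular in `S(T)` for `T = Spec (k ⊗_F k)`. So the
two pullbacks to `T` of the inverse of an `F`-point agree, and faithfully flat descent makes the
inverse an `F`-point, for any subfield `F`. -/

theorem semigroupPow_add_one (x : M) (n : ℕ+) :
    semigroupPow x (n + 1) = semigroupPow x n * x :=
  PNat.recOn_succ (p := fun _ => M) n x fun _ y => y * x

theorem semigroupPow_add (x : M) (m n : ℕ+) :
    semigroupPow x (m + n) = semigroupPow x m * semigroupPow x n := by
  induction n using PNat.recOn with
  | one => exact semigroupPow_add_one x m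
  | succ n ih => rw [← add_assoc, semigroupPow_add_one, ih, semigroupPow_add_one, mul_assoc]

theorem semigroupPow_coe (N : Subsemigroup M) (x : N) (n : ℕ+) :
    ((semigroupPow x n : N) : M) = semigroupPow (x : M) n := by
  induction n using PNat.recOn with
  | one => rfl
  | succ n ih => rw [semigroupPow_add_one, semigroupPow_add_one, ← ih]; rfl

/-- `w` is the inverse of `z` in some subgroup of the semigroup `M`. -/
structure IsGroupInverse (z w : M) : Prop where
  comm : z * w = w * z
  mul_mul_self : z * w * z = z
  mul_mul_inverse : w * z * w = w

namespace IsGroupInverse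

/-- The idempotents `z * v` and `z * w` coincide, so both inverses live in the same group. This
uniqueness is what lets inverses descend to `F`. -/
theorem unique {z v w : M} (hv : IsGroupInverse z v) (hw : IsGroupInverse z w) : v = w := by
  have h : z * v = z * w :=
    calc z * v = v * z := hv.comm
      _ = v * (z * w * z) := by rw [hw.mul_mul_self]
      _ = v * z * (w * z) := by simp only [mul_assoc]
      _ = z * v * (z * w) := by rw [hv.comm, hw.comm]
      _ = z * v * z * w := by simp only [mul_assoc]
      _ = z * w := by rw [hv.mul_mul_self]
  calc v = v * (z * v) := by rw [← mul_assoc, hv.mul_mul_inverse]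
    _ = v * z * w := by rw [h, mul_assoc]
    _ = w * z * w := by rw [← hv.comm, h, hw.comm]
    _ = w := hw.mul_mul_inverse

theorem map {N : Type*} [Semigroup N] {z w : M} (h : IsGroupInverse z w) (f : M →ₙ* N) :
    IsGroupInverse (f z) (f w) where
  comm := by rw [← map_mul, h.comm, map_mul]
  mul_mul_self := by rw [← map_mul, ← map_mul, h.mul_mul_self]
  mul_mul_inverse := by rw [← map_mul, ← map_mul, h.mul_mul_inverse]

/-- Evaluating `r * z * z * s` in two ways gives `z * s = r * z`, which is the idempotent of the
group containing `z`. -/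
theorem of_eq_sq_mul {z r s : M} (hs : z = z * z * s) (hr : z = r * (z * z)) :
    IsGroupInverse z (r * z * s) := by
  have e : z * s = r * z := by
    calc z * s = r * (z * z) * s := by rw [← hr]
      _ = r * (z * z * s) := by simp only [mul_assoc]
      _ = r * z := by rw [← hs]
  have h₁ : z * (r * z * s) = z * s := by
    calc z * (r * z * s) = z * (z * s * s) := by rw [e]
      _ = z * z * s * s := by simp only [mul_assoc]
      _ = z * s := by rw [← hs]
  have h₂ : r * z * s * z = z * s := by
    calc r * z * s * z = r * (z * s) * z := by simp only [mul_assoc]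
      _ = r * (r * (z * z)) := by rw [e]; simp only [mul_assoc]
      _ = z * s := by rw [← hr, e]
  refine ⟨h₁.trans h₂.symm, ?_, ?_⟩
  · rw [h₁, e, mul_assoc, ← hr]
  · rw [h₂]
    calc z * s * (r * z * s) = r * (z * (r * z * s)) := by rw [e]; simp only [mul_assoc]
      _ = r * z * s := by rw [h₁, mul_assoc]

/-- An element with a group inverse is a unit of the corner of the associated idempotent. -/
theorem exists_unit_corner {z w : M} (h : IsGroupInverse z w) :
    ∃ (e : M) (he : IsIdempotentElem e) (u : he.Cornerˣ), (u : he.Corner).1 = z := by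
  have he : IsIdempotentElem (z * w) := by
    rw [IsIdempotentElem, ← mul_assoc, h.mul_mul_self]
  have hz : z ∈ Subsemigroup.corner (z * w) :=
    (Subsemigroup.mem_corner_iff he).mpr
      ⟨h.mul_mul_self, by rw [h.comm, ← mul_assoc, h.mul_mul_self]⟩
  have hw : w ∈ Subsemigroup.corner (z * w) :=
    (Subsemigroup.mem_corner_iff he).mpr
      ⟨by rw [h.comm, h.mul_mul_inverse], by rw [← mul_assoc, h.mul_mul_inverse]⟩
  exact ⟨z * w, he, ⟨⟨z, hz⟩, ⟨w, hw⟩, Subtype.ext rfl, Subtype.ext h.comm.symm⟩, rfl⟩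

end IsGroupInverse

/-- Substitute `x ^ j = x ^ d * x ^ j * t` into itself `m - 1` times. The freedom in `m` later gives
the left and right relations a common exponent. -/
theorem exists_semigroupPow_eq_mul {x t : M} {j d : ℕ+}
    (h : semigroupPow x (j + d) * t = semigroupPow x j) (m : ℕ+) :
    ∃ s, semigroupPow x j = semigroupPow x (m * d) * semigroupPow x j * s := by
  rw [add_comm, semigroupPow_add] at h
  induction m using PNat.recOn with
  | one => exact ⟨t, by rw [one_mul, h]⟩
  | succ m ih =>
    obtain ⟨s, hs⟩ := ih
    refine ⟨s * t, ?_⟩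
    calc semigroupPow x j
        = semigroupPow x d * (semigroupPow x (m * d) * semigroupPow x j * s) * t := by
          rw [← hs, h]
      _ = semigroupPow x ((m + 1) * d) * semigroupPow x j * (s * t) := by
          rw [add_mul, one_mul, add_comm, semigroupPow_add x d]; simp only [mul_assoc]

theorem exists_semigroupPow_eq_mul' {x t : M} {j d : ℕ+}
    (h : t * semigroupPow x (j + d) = semigroupPow x j) (m : ℕ+) :
    ∃ s, semigroupPow x j = s * (semigroupPow x j * semigroupPow x (m * d)) := by
  rw [semigroupPow_add] at h
  induction m using PNat.recOn with
  | one => exact ⟨t, by rw [one_mul, h]⟩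
  | succ m ih =>
    obtain ⟨s, hs⟩ := ih
    refine ⟨t * s, ?_⟩
    calc semigroupPow x j
        = t * (s * (semigroupPow x j * semigroupPow x (m * d)) * semigroupPow x d) := by
          rw [← hs, h]
      _ = t * s * (semigroupPow x j * semigroupPow x ((m + 1) * d)) := by
          rw [add_mul, one_mul, semigroupPow_add x (m * d)]; simp only [mul_assoc]

/-- If the chains of principal one-sided ideals of the powers of `x` become stationary, then some
power of `x` has a group inverse. -/
theorem exists_isGroupInverse_semigroupPow {x s t : M} {i j i' j' : ℕ+} (hij : j < i)
    (h : semigroupPow x i * t = semigroupPow x j) (hij' : j' < i')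
    (h' : s * semigroupPow x i' = semigroupPow x j') :
    ∃ (n : ℕ+) (w : M), IsGroupInverse (semigroupPow x n) w := by
  obtain ⟨d, rfl⟩ : ∃ d, i = j + d := ⟨_, (PNat.add_sub_of_lt hij).symm⟩
  obtain ⟨d', rfl⟩ : ∃ d, i' = j' + d := ⟨_, (PNat.add_sub_of_lt hij').symm⟩
  -- The common exponent `n` is a multiple of both `d` and `d'`; the factor `j + j'` makes it exceed
  -- `j` and `j'`, so that both relations can be multiplied up to `x ^ n`.
  obtain ⟨t, ht⟩ := exists_semigroupPow_eq_mul h (d' * (j + j'))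
  obtain ⟨s, hs⟩ := exists_semigroupPow_eq_mul' h' (d * (j + j'))
  set n : ℕ+ := d' * (j + j') * d with hn
  have hn' : d * (j + j') * d' = n := by rw [hn]; ring
  rw [hn'] at hs
  have hle : j + j' ≤ n := by
    rw [← PNat.coe_le_coe, hn]
    push_cast
    calc (j + j' : ℕ) ≤ d' * (j + j') := Nat.le_mul_of_pos_left _ d'.pos
      _ ≤ _ := Nat.le_mul_of_pos_right _ d.pos
  obtain ⟨c, hc⟩ : ∃ c, n = j + c :=
    ⟨_, (PNat.add_sub_of_lt ((PNat.lt_add_right j j').trans_le hle)).symm⟩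
  obtain ⟨c', hc'⟩ : ∃ c, n = j' + c :=
    ⟨_, (PNat.add_sub_of_lt ((PNat.lt_add_left j' j).trans_le hle)).symm⟩
  refine ⟨n, _, .of_eq_sq_mul (s := t) (r := s) ?_ ?_⟩
  · calc semigroupPow x n = semigroupPow x c * (semigroupPow x n * semigroupPow x j * t) := by
          rw [← ht, ← semigroupPow_add, add_comm, ← hc]
      _ = semigroupPow x (c + n + j) * t := by
          rw [semigroupPow_add, semigroupPow_add]; simp only [mul_assoc]
      _ = semigroupPow x n * semigroupPow x n * t := by
          rw [← semigroupPow_add]; congr 2; rw [add_right_comm, add_comm c, ← hc]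
  · calc semigroupPow x n = s * (semigroupPow x j' * semigroupPow x n) * semigroupPow x c' := by
          rw [← hs, ← semigroupPow_add, ← hc']
      _ = s * semigroupPow x (j' + n + c') := by
          rw [semigroupPow_add, semigroupPow_add]; simp only [mul_assoc]
      _ = s * (semigroupPow x n * semigroupPow x n) := by
          rw [← semigroupPow_add]; congr 2; rw [add_right_comm, ← hc']

end Semigroups

/-! ### Noetherian spaces and constructible images -/

section Topology

open TopologicalSpace

variable {X P : Type*} [TopologicalSpace X] [TopologicalSpace P]

/-- A constructible set is generically constant on every nonempty set. -/
theorem Topology.IsConstructible.exists_isOpen_inter {C : Set P} (hC : IsConstructible C) :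
    ∀ {A : Set P}, A.Nonempty →
      ∃ W, IsOpen W ∧ (W ∩ A).Nonempty ∧ (W ∩ A ⊆ C ∨ W ∩ A ⊆ Cᶜ) := by
  induction hC using IsConstructible.empty_union_induction with
  | open_retrocompact U hU _ =>
    intro A hA
    by_cases h : (U ∩ A).Nonempty
    · exact ⟨U, hU, h, .inl Set.inter_subset_left⟩
    · refine ⟨Set.univ, isOpen_univ, by simpa using hA, .inr fun a ha hU => h ⟨a, hU, ha.2⟩⟩
  | union s _ t _ ihs iht =>
    intro A hA
    obtain ⟨W, hW, hWA, h⟩ := ihs hA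
    obtain ⟨W', hW', hWA', h'⟩ := iht hWA
    refine ⟨W' ∩ W, hW'.inter hW, by rwa [Set.inter_assoc], ?_⟩
    rw [Set.inter_assoc]
    rcases h with h | h
    · exact .inl fun a ha => .inl (h ha.2)
    rcases h' with h' | h'
    · exact .inl fun a ha => .inr (h' ha)
    · exact .inr fun a ha => by rintro (hs | ht); exacts [h ha.2 hs, h' ha ht]
  | compl s _ ih =>
    intro A hA
    obtain ⟨W, hW, hWA, h⟩ := ih hA
    exact ⟨W, hW, hWA, by rw [compl_compl]; exact h.symm⟩

theorem exists_closure_image_Ici_stationary [NoetherianSpace X] (p : ℕ → X) :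
    ∃ n, ∀ m, closure (p '' Set.Ici n) ⊆ closure (p '' Set.Ici m) := by
  let T : ℕ →o (Closeds X)ᵒᵈ :=
    ⟨fun n => OrderDual.toDual ⟨closure (p '' Set.Ici n), isClosed_closure⟩, fun a b hab =>
      closure_mono (Set.image_mono (Set.Ici_subset_Ici.mpr hab))⟩
  have : WellFoundedGT (Closeds X)ᵒᵈ := by
    have : WellFoundedLT (Closeds X) :=
      ((noetherianSpace_TFAE X).out 0 1).mp ‹NoetherianSpace X›
    infer_instance
  obtain ⟨n, hn⟩ := WellFoundedGT.monotone_chain_condition T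
  refine ⟨n, fun m => ?_⟩
  have h : closure (p '' Set.Ici n) = closure (p '' Set.Ici (max n m)) :=
    congrArg (fun Z : (Closeds X)ᵒᵈ => ((OrderDual.ofDual Z : Closeds X) : Set X)) (hn _ (le_max_left n m))
  rw [h]
  exact closure_mono (Set.image_mono (Set.Ici_subset_Ici.mpr (le_max_right n m)))

/-- Let `q i j` be points of a "product" `P` of `X` with itself, `q i j` being the pair of the
points `p i` and `p j` in the sense that it depends continuously on each of them. If `φ` is a
continuous self-map of `P` with constructible images which acts on these points by
`(i, j) ↦ (i, i + j + 1)`, then its range contains some `q i j` with `j < i`. -/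
theorem exists_mem_range_of_shear [NoetherianSpace X] (p : ℕ → X) (q : ℕ → ℕ → P)
    (hq₁ : ∀ j, ∃ s : X → P, Continuous s ∧ ∀ i, s (p i) = q i j)
    (hq₂ : ∀ i, ∃ s : X → P, Continuous s ∧ ∀ j, s (p j) = q i j)
    {φ : P → P} (hφ : Continuous φ)
    (hc : ∀ Z, IsClosed Z → Topology.IsConstructible (φ '' Z))
    (hφq : ∀ i j, φ (q i j) = q i (i + j + 1)) :
    ∃ i j, j < i ∧ q i j ∈ Set.range φ := by
  obtain ⟨n, hn⟩ := exists_closure_image_Ici_stationary p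
  set B : Set P := {a | ∃ i j, n ≤ i ∧ n ≤ j ∧ q i j = a} with hB
  have hmem : ∀ {i}, n ≤ i → ∀ m, p i ∈ closure (p '' Set.Ici m) := fun hi m =>
    hn m (subset_closure ⟨_, hi, rfl⟩)
  -- Density of the image: `q i j` is a limit of points `q i l` with `l > n + i`, and these are `φ
  -- (q i (l - i - 1))`.
  have hZC : closure B ⊆ closure (φ '' closure B) := by
    refine closure_minimal ?_ isClosed_closure
    rintro _ ⟨i, j, hi, hj, rfl⟩
    obtain ⟨s, hs, hsq⟩ := hq₂ i
    rw [← hsq]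
    refine map_mem_closure hs (hmem hj (n + i + 1)) ?_
    rintro _ ⟨l, hl, rfl⟩
    rw [Set.mem_Ici] at hl
    refine ⟨q i (l - i - 1), subset_closure ⟨i, l - i - 1, hi, by omega, rfl⟩, ?_⟩
    rw [hφq, hsq]
    congr 1
    omega
  have hCZ : φ '' closure B ⊆ closure B := by
    refine (image_closure_subset_closure_image hφ).trans (closure_mono ?_)
    rintro _ ⟨_, ⟨i, j, hi, hj, rfl⟩, rfl⟩
    exact ⟨i, i + j + 1, hi, by omega, (hφq i j).symm⟩
  have hne : (closure B).Nonempty := ⟨_, subset_closure ⟨n, n, le_rfl, le_rfl, rfl⟩⟩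
  obtain ⟨W, hW, ⟨a, haW, haB⟩, h⟩ := (hc _ isClosed_closure).exists_isOpen_inter hne
  have hsub : W ∩ closure B ⊆ φ '' closure B := by
    refine h.resolve_right fun h => ?_
    obtain ⟨b, hbW, hb⟩ := mem_closure_iff.mp (hZC haB) W hW haW
    exact h ⟨hbW, hCZ hb⟩ hb
  obtain ⟨_, hbW, i, j, hi, hj, rfl⟩ := mem_closure_iff.mp haB W hW haW
  -- With `j` fixed, `p i` is in the closure of every tail, so `i` can be replaced by some `l > j`
  -- without leaving `W`.
  obtain ⟨s, hs, hsq⟩ := hq₁ j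
  rw [← hsq] at hbW
  obtain ⟨_, hlW, l, hl, rfl⟩ :=
    mem_closure_iff.mp (hmem hi (n + j + 1)) _ (hW.preimage hs) hbW
  rw [Set.mem_Ici] at hl
  rw [Set.mem_preimage, hsq] at hlW
  obtain ⟨c, -, hc⟩ := hsub ⟨hlW, subset_closure ⟨l, j, by omega, hj, rfl⟩⟩
  exact ⟨l, j, by omega, c, hc⟩

end Topology

/-! ### From topological points to `k`-points -/

section Points

variable {k : Type u} [Field k]

/-- Nullstellensatz: the fibre over the closed point of `y` is closed and nonempty in a Jacobson
space, so it has a closed point, which is a `k`-point. A `k`-point of `Q` is determined by its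
underlying point. -/
theorem exists_section_fac_of_mem_range [IsAlgClosed k] {P Q : Scheme.{u}}
    (f : P ⟶ Q) (g : Q ⟶ Spec (.of k)) [LocallyOfFiniteType f] [LocallyOfFiniteType g]
    {y : Spec (.of k) ⟶ Q} (hy : y ≫ g = 𝟙 _)
    (h : y (IsLocalRing.closedPoint k) ∈ Set.range f) :
    ∃ z : Spec (.of k) ⟶ P, z ≫ f = y := by
  have hcl : IsClosed {y (IsLocalRing.closedPoint k)} :=
    (pointEquivClosedPoint g ⟨y, hy⟩).2
  have hcl' : IsClosed (f ⁻¹' {y (IsLocalRing.closedPoint k)}) := hcl.preimage f.continuous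
  have : JacobsonSpace P := LocallyOfFiniteType.jacobsonSpace (f ≫ g)
  obtain ⟨a, ha⟩ := h
  obtain ⟨b, hb, hb'⟩ : (f ⁻¹' {y (IsLocalRing.closedPoint k)} ∩ closedPoints P).Nonempty := by
    rw [← closure_nonempty_iff, JacobsonSpace.closure_inter_closedPoints_eq_closure
      hcl'.isLocallyClosed, closure_nonempty_iff]
    exact ⟨a, ha⟩
  rw [mem_closedPoints_iff] at hb'
  refine ⟨pointOfClosedPoint (f ≫ g) b hb', ext_of_apply_closedPoint_eq g ?_ hy ?_⟩
  · rw [Category.assoc, pointOfClosedPoint_comp]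
  · exact (Scheme.Hom.comp_apply _ _ _).trans
      ((congrArg f (pointOfClosedPoint_apply (f ≫ g) b hb' _)).trans hb)

/-- The point of the topological space of `X` underlying a `k`-point. -/
noncomputable def underlyingPoint {X : Over (Spec (.of k))} (x : 𝟙_ (Over (Spec (.of k))) ⟶ X) :
    X.left :=
  x.left (IsLocalRing.closedPoint k)

theorem underlyingPoint_comp {X Y : Over (Spec (.of k))} (x : 𝟙_ (Over (Spec (.of k))) ⟶ X)
    (f : X ⟶ Y) : underlyingPoint (x ≫ f) = f.left (underlyingPoint x) :=
  Scheme.Hom.comp_apply _ _ _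

theorem isNoetherian_of_finiteType (X : Over (Spec (.of k))) [LocallyOfFiniteType X.hom]
    [QuasiCompact X.hom] : IsNoetherian X.left where
  toIsLocallyNoetherian := LocallyOfFiniteType.isLocallyNoetherian X.hom
  toCompactSpace := QuasiCompact.compactSpace_of_compactSpace X.hom

/-- Let `X` be of finite type over an algebraically closed field `k`, with a multiplication `m`.
If `x i` are `k`-points that multiply like the powers of an element, then `x j ∈ x i * X(k)` for
some `j < i`. -/
theorem exists_lift_comp_eq [IsAlgClosed k] {X : Over (Spec (.of k))} [LocallyOfFiniteType X.hom]
    [QuasiCompact X.hom] (m : X ⊗ X ⟶ X) (x : ℕ → (𝟙_ (Over (Spec (.of k))) ⟶ X))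
    (hx : ∀ i j, lift (x i) (x j) ≫ m = x (i + j + 1)) :
    ∃ i j, j < i ∧ ∃ t, lift (x i) t ≫ m = x j := by
  have : LocallyOfFiniteType (X ⊗ X).hom := by
    rw [Over.tensorObj_hom]; infer_instance
  have : QuasiCompact (X ⊗ X).hom := by
    rw [Over.tensorObj_hom]; infer_instance
  have := isNoetherian_of_finiteType X
  have := isNoetherian_of_finiteType (X ⊗ X)
  let φ : X ⊗ X ⟶ X ⊗ X := lift (fst X X) m
  have : LocallyOfFiniteType (φ.left ≫ (X ⊗ X).hom) := by rw [Over.w]; infer_instance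
  have : LocallyOfFiniteType φ.left := locallyOfFiniteType_of_comp φ.left (X ⊗ X).hom
  obtain ⟨i, j, hij, h⟩ := exists_mem_range_of_shear (fun i => underlyingPoint (x i))
    (fun i j => underlyingPoint (lift (x i) (x j)))
    (fun j => ⟨(lift (𝟙 X) (toUnit X ≫ x j)).left, Scheme.Hom.continuous _, fun i => by
      rw [← underlyingPoint_comp]; simp⟩)
    (fun i => ⟨(lift (toUnit X ≫ x i) (𝟙 X)).left, Scheme.Hom.continuous _, fun j => by
      rw [← underlyingPoint_comp]; simp⟩)
    (φ := φ.left) (Scheme.Hom.continuous _)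
    (fun Z hZ => φ.left.isConstructible_image (by
      rw [← Topology.isConstructible_compl]
      exact (TopologicalSpace.NoetherianSpace.isCompact _).isConstructible hZ.isOpen_compl))
    (fun i j => by rw [← underlyingPoint_comp]; simp [φ, hx])
  obtain ⟨z, hz⟩ := exists_section_fac_of_mem_range φ.left (X ⊗ X).hom
    (Over.w (lift (x i) (x j))) h
  let z' : 𝟙_ (Over (Spec (.of k))) ⟶ X ⊗ X := Over.homMk z (by
    rw [← Over.w φ, reassoc_of% hz]; exact Over.w (lift (x i) (x j)))
  have hz' : z' ≫ φ = lift (x i) (x j) := Over.OverMorphism.ext hz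
  refine ⟨i, j, hij, z' ≫ snd X X, ?_⟩
  have h₁ : z' ≫ fst X X = x i := by simpa [φ] using congrArg (· ≫ fst X X) hz'
  have h₂ : z' ≫ m = x j := by simpa [φ] using congrArg (· ≫ snd X X) hz'
  rw [← h₁, ← h₂]
  congr 1
  ext1 <;> simp

end Points

/-! ### Group inverses of powers of `k`-points -/

namespace AlgebraicSemigroup

variable {k : Type u} [Field k] (S : AlgebraicSemigroup k)

/-- Some power of every `k`-point has a group inverse. -/
theorem exists_isGroupInverse [IsAlgClosed k] (x : S.Points) :
    ∃ (n : ℕ+) (w : S.Points), IsGroupInverse (semigroupPow x n) w := by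
  have := S.locallyOfFiniteType
  have := S.quasiCompact
  -- Index `i` stands for the power `x ^ (i + 1)`, whence the shift in `i + j + 1`.
  have hpow (i j : ℕ) : semigroupPow x i.succPNat * semigroupPow x j.succPNat =
      semigroupPow x (i + j + 1).succPNat := by
    rw [← semigroupPow_add]
    congr 1
    rw [← PNat.coe_inj]
    simp only [PNat.add_coe, Nat.succPNat_coe]
    omega
  let p (i : ℕ) : 𝟙_ (Over (Spec (.of k))) ⟶ S.X := show S.Points from semigroupPow x i.succPNat
  obtain ⟨i, j, hij, t, ht⟩ := exists_lift_comp_eq S.mul p hpow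
  -- The opposite multiplication yields the relation for left ideals.
  obtain ⟨i', j', hij', s, hs⟩ := exists_lift_comp_eq (lift (snd S.X S.X) (fst S.X S.X) ≫ S.mul)
    p (fun i j => by
      rw [← Category.assoc, comp_lift, lift_snd, lift_fst, add_comm i j]
      exact hpow j i)
  rw [← Category.assoc, comp_lift, lift_snd, lift_fst] at hs
  exact exists_isGroupInverse_semigroupPow (t := (t : S.Points)) (s := (s : S.Points))
    (Nat.succPNat_lt_succPNat.mpr hij) ht (Nat.succPNat_lt_succPNat.mpr hij') hs

theorem Points.left_comp_hom_comp {S : AlgebraicSemigroup k} (x : S.Points) {Z : Scheme.{u}}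
    (h : Spec (.of k) ⟶ Z) : Over.Hom.left x ≫ S.X.hom ≫ h = h :=
  (Over.w_assoc (show 𝟙_ (Over (Spec (.of k))) ⟶ S.X from x) h).trans (Category.id_comp h)

/-- The semigroup `S(T)` of `T`-points of `S`. -/
noncomputable abbrev pointSemigroup (T : Over (Spec (.of k))) : Semigroup (T ⟶ S.X) where
  mul x y := lift x y ≫ S.mul
  mul_assoc x y z := S.lift_mul_assoc x y z

/-! ### Descent of group inverses to `F` -/

namespace FStructure

variable {S} {F : Type u} [Field F] [Algebra F k] (A : S.FStructure F)

/-- Here `f` need not be a `k`-morphism: after projection to `X₀` the multiplication is that of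
`mul₀`, which does not see the `k`-structure. -/
theorem lift_mul_left_proj {T T' : Over (Spec (.of k))} (f : T'.left ⟶ T.left)
    {x y : T ⟶ S.X} {x' y' : T' ⟶ S.X} (hx : x'.left ≫ A.proj = f ≫ x.left ≫ A.proj)
    (hy : y'.left ≫ A.proj = f ≫ y.left ≫ A.proj) :
    (lift x' y' ≫ S.mul).left ≫ A.proj = f ≫ (lift x y ≫ S.mul).left ≫ A.proj := by
  rw [Over.comp_left, Over.comp_left, Category.assoc, Category.assoc, A.mul_proj,
    ← Category.assoc, ← Category.assoc, ← Category.assoc]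
  congr 1
  apply pullback.hom_ext
  · simp only [Category.assoc, Over.lift_left, pullback.map, pullback.lift_fst,
      pullback.lift_fst_assoc, hx]
  · simp only [Category.assoc, Over.lift_left, pullback.map, pullback.lift_snd,
      pullback.lift_snd_assoc, hy]

/-- A morphism of `F`-schemes `f : T ⟶ Spec k` from a `k`-scheme `T` induces a homomorphism
`S(k) → S(T)`. -/
noncomputable def pointMap {T : Over (Spec (.of k))} (f : T.left ⟶ Spec (.of k))
    (hf : f ≫ specMap F k = T.hom ≫ specMap F k) :
    letI := S.pointSemigroup T
    S.Points →ₙ* (T ⟶ S.X) :=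
  letI := S.pointSemigroup T
  { toFun x := Over.homMk (A.isPullback.lift (f ≫ Over.Hom.left x ≫ A.proj) T.hom (by
      rw [Category.assoc, Category.assoc, A.isPullback.w, ← hf]
      exact congrArg (f ≫ ·) (x.left_comp_hom_comp _)))
      (A.isPullback.lift_snd ..)
    map_mul' x y := by
      ext1
      refine A.isPullback.hom_ext ?_ ?_
      · exact (A.isPullback.lift_fst ..).trans (A.lift_mul_left_proj
          (T := 𝟙_ (Over (Spec (.of k)))) f (x := x) (y := y)
          (x' := Over.homMk _ (A.isPullback.lift_snd ..))
          (y' := Over.homMk _ (A.isPullback.lift_snd ..))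
          (A.isPullback.lift_fst ..) (A.isPullback.lift_fst ..)).symm
      · exact (A.isPullback.lift_snd ..).trans (Over.w _).symm }

theorem pointMap_left_proj {T : Over (Spec (.of k))} (f : T.left ⟶ Spec (.of k))
    (hf : f ≫ specMap F k = T.hom ≫ specMap F k) (x : S.Points) :
    (A.pointMap f hf x).left ≫ A.proj = f ≫ Over.Hom.left x ≫ A.proj :=
  A.isPullback.lift_fst ..

variable {A}

/-- Faithfully flat descent: `Spec k ⟶ Spec F` is the coequalizer of its kernel pair, even for maps
to non-affine schemes. -/
theorem IsRational.of_fst_comp_eq {x : S.Points}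
    (h : pullback.fst (specMap F k) (specMap F k) ≫ Over.Hom.left x ≫ A.proj =
      pullback.snd (specMap F k) (specMap F k) ≫ Over.Hom.left x ≫ A.proj) :
    A.IsRational x := by
  have ⟨_, _⟩ : Flat (specMap F k) ∧ Surjective (specMap F k) := by
    rw [flat_and_surjective_SpecMap_iff]
    exact RingHom.faithfullyFlat_algebraMap_iff.mpr inferInstance
  have : IsRegularEpi (specMap F k) := isRegularEpi_of_flat_of_surjective_of_isAffine _
  obtain ⟨g, hg⟩ := IsRegularEpi.exists_of_isKernelPair (specMap F k)
    (IsPullback.of_hasPullback _ _) _ h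
  refine ⟨Over.homMk g ?_, hg.symm⟩
  rw [← cancel_epi (specMap F k), reassoc_of% hg, A.isPullback.w]
  exact (x.left_comp_hom_comp _).trans (Category.comp_id _).symm

/-- The group inverse of a rational point is rational. -/
theorem IsRational.of_isGroupInverse {z w : S.Points} (hz : A.IsRational z)
    (h : IsGroupInverse z w) : A.IsRational w := by
  -- `T` is a `k`-scheme through the first projection, so `p₂` is only a morphism over `F`;
  -- `pointMap` allows this.
  let T : Over (Spec (.of k)) := Over.mk (pullback.fst (specMap F k) (specMap F k))
  let p₁ : T.left ⟶ Spec (.of k) := pullback.fst (specMap F k) (specMap F k)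
  let p₂ : T.left ⟶ Spec (.of k) := pullback.snd (specMap F k) (specMap F k)
  have hp₁ : p₁ ≫ specMap F k = T.hom ≫ specMap F k := rfl
  have hp₂ : p₂ ≫ specMap F k = T.hom ≫ specMap F k := pullback.condition.symm
  let := S.pointSemigroup T
  obtain ⟨z₀, hz₀⟩ := hz
  have hz : A.pointMap p₁ hp₁ z = A.pointMap p₂ hp₂ z := by
    ext1
    refine A.isPullback.hom_ext ?_ ((Over.w _).trans (Over.w _).symm)
    rw [pointMap_left_proj, pointMap_left_proj, hz₀, reassoc_of% hp₁, reassoc_of% hp₂]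
  have hw : A.pointMap p₁ hp₁ w = A.pointMap p₂ hp₂ w :=
    (h.map (A.pointMap p₁ hp₁)).unique (hz ▸ h.map (A.pointMap p₂ hp₂))
  apply IsRational.of_fst_comp_eq
  have := congrArg (fun y => Over.Hom.left y ≫ A.proj) hw
  simpa only [pointMap_left_proj] using this

end FStructure

end AlgebraicSemigroup

theorem theorem1 {k : Type u} [Field k] [IsAlgClosed k] {F : Type u} [Field F] [Algebra F k]
    (S : AlgebraicSemigroup k) (A : S.FStructure F) :
    IsStronglyPiRegular A.rationalPoints := by
  intro x
  obtain ⟨n, w, h⟩ := S.exists_isGroupInverse (x : S.Points)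
  rw [← semigroupPow_coe] at h
  have hw : w ∈ A.rationalPoints :=
    AlgebraicSemigroup.FStructure.IsRational.of_isGroupInverse (semigroupPow x n).2 h
  have h' : IsGroupInverse (semigroupPow x n) (⟨w, hw⟩ : A.rationalPoints) :=
    ⟨Subtype.ext h.comm, Subtype.ext h.mul_mul_self, Subtype.ext h.mul_mul_inverse⟩
  exact ⟨n, h'.exists_unit_corner⟩
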